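/- **Conventions.** Let $I=[0,1]$. For a space $Y$ and $y\in Y$, $P(Y,y)$ is the space of continuous paths $\alpha:I\to Y$ with $\alpha(0)=y$, with the compact-open topology, and $ev_1:P(Y,y)\to Y$ is $ev_1(\alpha)=\alpha(1)$. A continuous map $p:E\to X$ has the *continuous path-covering property* if for every $e\in E$ the map $P(E,e)\to P(X,p(e))$, $\alpha\mapsto p\circ\alpha$, is a homeomorphism. Total spaces $E$ of such maps are always assumed non-empty and path-connected. The group $\pi_1(X,x_0)$ carries the quotient topology inherited from the loop space $\Omega(X,x_0)$ with the compact-open topology, and for $H\le\pi_1(X,x_0)$ the coset space $\pi_1(X,x_0)/H=\{H[\alpha]\}$ carries the quotient topology. A space is *totally path-disconnected* if every path in it is constant. Two maps $p_1:E_1\to X$, $p_2:E_2\to X$ with the continuous path-covering property are *equivalent* if there is a homeomorphism $h:E_1\to E_2$ with $p_2\circ h=p_1$. A *simple weak equivalence* between them consists of a map $p_3:E_3\to X$ with the continuous path-covering property and bijective weak homotopy equivalences $f_i:E_3\to E_i$ with $p_i\circ f_i=p_3$ ($i=1,2$). They are *weakly equivalent* if they are connected by a finite chain of simple weak equivalences.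 A based map $p:(E,e_0)\to(X,x_0)$ with the continuous path-covering property *corresponds* to $H$ if $p_\#(\pi_1(E,e_0))=H$. **Theorem 1.2.** Let $X$ be a path-connected Hausdorff space and $x_0\in X$. * For every subgroup $H\le\pi_1(X,x_0)$, there is a map $p:(E,e_0)\to(X,x_0)$ with the continuous path-covering property and $p_\#(\pi_1(E,e_0))=H$ if and only if $\pi_1(X,x_0)/H$ is totally path-disconnected; any two such maps are weakly equivalent. Moreover, if $p_1:(E_1,e_1)\to(X,x_0)$ and $p_2:(E_2,e_2)\to(X,x_0)$ have the continuous path-covering property and correspond to $H_1$ and $H_2$, then $p_1$ and $p_2$ are weakly equivalent if and only if $H_1$ and $H_2$ are conjugate in $\pi_1(X,x_0)$. * (1) Among the maps whose total space has quotient endpoint evaluation the classification is up to equivalence: for every $H\le\pi_1(X,x_0)$, there is a map $p:(E,e_0)\to(X,x_0)$ with the continuous path-covering property for which $ev_1:P(E,e_0)\to E$ is a quotient map and $p_\#(\pi_1(E,e_0))=H$ if and only if $\pi_1(X,x_0)/H$ is totally path-disconnected; any two such maps are equivalent. Moreover, two maps $p_i:(E_i,e_i)\to(X,x_0)$ with the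 continuous path-covering property for which $ev_1:P(E_i,e_i)\to E_i$ is a quotient map, corresponding to $H_1$ and $H_2$, are equivalent if and only if $H_1$ and $H_2$ are conjugate in $\pi_1(X,x_0)$. * (2) Every map $p:E\to X$ with the continuous path-covering property is weakly equivalent to a map $p':E'\to X$ with the continuous path-covering property for which $ev_1:P(E',e')\to E'$ is a quotient map for every $e'\in E'$. -/

import Mathlib

open scoped unitInterval Topology Topology.Homotopy

universe u

/-- The based path space `P(X, x)`: all paths `α : I → X` with `α 0 = x`, with the (subspace of the)
compact-open topology. -/
abbrev BasedPath (X : Type u) [TopologicalSpace X] (x : X) : Type u :=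
  {α : C(I, X) // α 0 = x}

namespace BasedPath

variable {X Y : Type u} [TopologicalSpace X] [TopologicalSpace Y]

/-- The map `P(f) : P(X, x) → P(Y, f x)`, `α ↦ f ∘ α`. -/
def map (f : C(X, Y)) (x : X) (α : BasedPath X x) : BasedPath Y (f x) :=
  ⟨f.comp α.1, congrArg f α.2⟩

/-- The endpoint evaluation `ev₁ : P(X, x) → X`, `α ↦ α 1`. -/
def ev₁ (x : X) (α : BasedPath X x) : X := α.1 1

end BasedPath

/-- `p` has the continuous path-covering property: for every point `e` of the domain,
`P(p) : P(E, e) → P(X, p e)` is a homeomorphism. -/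
def HasContinuousPathCovering {E X : Type u} [TopologicalSpace E] [TopologicalSpace X]
    (p : C(E, X)) : Prop :=
  ∀ e : E, IsHomeomorph (BasedPath.map p e)

/-- A space is totally path-disconnected if two points joined by a path are equal, i.e. every path
in it is constant. -/
def TotallyPathDisconnected (Y : Type u) [TopologicalSpace Y] : Prop :=
  ∀ x y : Y, Joined x y → x = y

/-- The quotient topology on `π₁(X, x)` inherited from the loop space `Ω(X, x)` with the
compact-open topology. The coset space `π₁(X, x) ⧸ H` then carries Mathlib's quotient topology. Since
the product in Mathlib's `FundamentalGroup` is `[α] * [β] = [β · α]`, the left cosets that make up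
`π₁(X, x) ⧸ H` are the classes `{[η · α] | [η] ∈ H}`, that is `H[α]` in the notation in which
`[α][β] = [α · β]`. -/
instance FundamentalGroup.instTopologicalSpaceQuotient (X : Type u) [TopologicalSpace X] (x : X) :
    TopologicalSpace (FundamentalGroup X x) :=
  TopologicalSpace.coinduced
    (fun γ : Path x x => FundamentalGroup.fromPath (Path.Homotopic.Quotient.mk γ)) inferInstance

section WeakHomotopyEquivalence

variable {X Y : Type u} [TopologicalSpace X] [TopologicalSpace Y]

/-- The map induced by `f` on sets of path components. -/
def zerothHomotopyMap (f : C(X, Y)) : ZerothHomotopy X → ZerothHomotopy Y :=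
  Quotient.map f fun _ _ h => h.map f.continuous

/-- The map `Ωⁿ(X, x) → Ωⁿ(Y, f x)`, `α ↦ f ∘ α`. -/
def genLoopMap (f : C(X, Y)) (n : ℕ) (x : X) (α : Ω^ (Fin n) X x) : Ω^ (Fin n) Y (f x) :=
  ⟨f.comp α.1, fun y hy => congrArg f (α.2 y hy)⟩

/-- The map `f_# : πₙ(X, x) → πₙ(Y, f x)`. -/
def homotopyGroupMap (f : C(X, Y)) (n : ℕ) (x : X) : π_ n X x → π_ n Y (f x) :=
  Quotient.map (genLoopMap f n x) fun _ _ h => h.map fun F => F.compContinuousMap f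

/-- `f` is a weak homotopy equivalence: it induces a bijection on path components and isomorphisms
`πₙ(X, x) → πₙ(Y, f x)` for all `n ≥ 1` and all `x`. -/
def IsWeakHomotopyEquiv (f : C(X, Y)) : Prop :=
  Function.Bijective (zerothHomotopyMap f) ∧
    ∀ n : ℕ, 1 ≤ n → ∀ x : X, Function.Bijective (homotopyGroupMap f n x)

end WeakHomotopyEquivalence

/-- A map `p : E → X` with the continuous path-covering property, where `E` is a (nonempty)
path-connected space. -/
structure ContPathCovering (X : Type u) [TopologicalSpace X] where
  /-- the total space -/
  E : Type u
  [top : TopologicalSpace E]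
  [pathConnected : PathConnectedSpace E]
  /-- the map -/
  p : C(E, X)
  covering : HasContinuousPathCovering p

namespace ContPathCovering

attribute [instance] ContPathCovering.top ContPathCovering.pathConnected

variable {X : Type u} [TopologicalSpace X]

/-- `P` is a map of based spaces `(E, e₀) → (X, x₀)` with `p_#(π₁(E, e₀)) = H`. -/
def Corresponds (P : ContPathCovering X) (e₀ : P.E) {x₀ : X}
    (H : Subgroup (FundamentalGroup X x₀)) : Prop :=
  ∃ h : P.p e₀ = x₀, (FundamentalGroup.mapOfEq P.p h).range = H

/-- Two maps over `X` are equivalent if there is a homeomorphism of total spaces over `X`. -/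
def Equivalent (P₁ P₂ : ContPathCovering X) : Prop :=
  ∃ h : P₁.E ≃ₜ P₂.E, ∀ e, P₂.p (h e) = P₁.p e

/-- There is a simple weak equivalence between `P₁` and `P₂`: a map `P₃` with the continuous
path-covering property and bijective weak homotopy equivalences `E₃ → E₁`, `E₃ → E₂` over `X`. -/
def SimplyWeaklyEquivalent (P₁ P₂ : ContPathCovering X) : Prop :=
  ∃ (P₃ : ContPathCovering X) (f₁ : C(P₃.E, P₁.E)) (f₂ : C(P₃.E, P₂.E)),
    (Function.Bijective f₁ ∧ IsWeakHomotopyEquiv f₁ ∧ P₁.p.comp f₁ = P₃.p) ∧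
    (Function.Bijective f₂ ∧ IsWeakHomotopyEquiv f₂ ∧ P₂.p.comp f₂ = P₃.p)

/-- Weak equivalence: being connected by a finite chain of simple weak equivalences. -/
def WeaklyEquivalent : ContPathCovering X → ContPathCovering X → Prop :=
  Relation.ReflTransGen SimplyWeaklyEquivalent

end ContPathCovering

/-- Two subgroups are conjugate: `K = g H g⁻¹` for some `g`. -/
def AreConjugate {G : Type u} [Group G] (H K : Subgroup G) : Prop :=
  ∃ g : G, H.map (MulAut.conj g).toMonoidHom = K

/-!
A map `p : E → X` with the continuous path-covering property lifts each path from `p e` uniquely, and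
the endpoint of the lift depends continuously on the path (`HasContinuousPathCovering.liftEnd`). So
homotopic paths have lifts with the same endpoint, and the subgroup that corresponds to `(E, e₀)`
consists of the classes of the loops whose lifts close up (`ContPathCovering.corresponds_iff`). Two
paths from `x₀` lift to paths with the same endpoint iff they differ by an element of `H`.
Lifting loops therefore gives a continuous injection of `π₁(X, x₀) ⧸ H` into a fiber of `p`. By
unique lifting a path in a fiber is constant, so `π₁(X, x₀) ⧸ H` is totally path-disconnected
(`ContPathCovering.Corresponds.totallyPathDisconnected`).

Conversely, let `PathSpaceQuotient H` be the quotient of `P(X, x₀)` that identifies paths with the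
same endpoint that differ by an element of `H`. A path `γ` lifts at `[a]` to `t ↦ [a · γ_t]`, where
`γ_t` is an initial segment of `γ`, and this lift is continuous in `γ`. What remains is uniqueness
(`PathSpaceQuotient.eq_mk_trans_segment`): if `β` lies over `γ` and `b` represents `β t`, then the
coset of `[b · γ_t⁻¹ · a⁻¹]` is a continuous function of `t`, hence constant if
`π₁(X, x₀) ⧸ H` is totally path-disconnected. For continuity, the quotient map from `P(X, x₀)`
has to stay a quotient map after a product with `I` and a restriction to the part over the graph of
`γ`; this holds since `I` is locally compact and the graph condition is closed, `X` being Hausdorff.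

For every other `(E, e₀)` that corresponds to `H`, the map `liftEnd` descends to a continuous
bijection `PathSpaceQuotient H → E` over `X` (`PathSpaceQuotient.exists_bijective_map`), which is a
homeomorphism if `ev₁` is a quotient map. A continuous bijection over `X` between such total
spaces is a weak homotopy equivalence, since maps from cubes lift through it along a contraction of
the cube (`HasContinuousPathCovering.isWeakHomotopyEquiv_of_bijective`). This gives uniqueness in
both classifications. Finally, moving the base point of `E` within a fiber conjugates the subgroup
(`ContPathCovering.Corresponds.conj`), and maps over `X` that are injective do not change it.
-/

/-! ### Paths, loop classes and based path spaces -/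

section Paths

variable {X : Type u} [TopologicalSpace X] {x₀ y : X}

/-- The class `[a · b⁻¹] ∈ π₁(X, x₀)` of two paths `a`, `b` from `x₀` with the same endpoint. -/
noncomputable def loopClass (a b : Path x₀ y) : FundamentalGroup X x₀ :=
  FundamentalGroup.fromPath (Path.Homotopic.Quotient.mk (a.trans b.symm))

open CategoryTheory in
theorem loopClass_eq_comp (a b : Path x₀ y) :
    loopClass a b =
      ((show (FundamentalGroupoid.mk x₀ ⟶ FundamentalGroupoid.mk y) from .mk a) ≫
        inv (show (FundamentalGroupoid.mk x₀ ⟶ FundamentalGroupoid.mk y) from .mk b) :) := by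
  rw [← Groupoid.inv_eq_inv]
  rfl

theorem loopClass_refl_right (a : Path x₀ x₀) :
    loopClass a (Path.refl x₀) = FundamentalGroup.fromPath (.mk a) := by
  rw [loopClass, Path.refl_symm, Path.Homotopic.Quotient.mk_trans, Path.Homotopic.Quotient.mk_refl,
    Path.Homotopic.Quotient.trans_refl]

@[simp]
theorem loopClass_self (a : Path x₀ y) : loopClass a a = 1 := by
  rw [loopClass_eq_comp, CategoryTheory.IsIso.hom_inv_id]
  rfl

/-- The order of the factors is the one of Mathlib's product `[α] * [β] = [β · α]`. -/
theorem loopClass_mul (a b c : Path x₀ y) : loopClass b c * loopClass a b = loopClass a c := by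
  simp only [loopClass_eq_comp]
  change CategoryTheory.CategoryStruct.comp _ _ = _
  simp

theorem loopClass_inv (a b : Path x₀ y) : (loopClass a b)⁻¹ = loopClass b a :=
  inv_eq_of_mul_eq_one_left (by rw [loopClass_mul, loopClass_self])

/-- The homotopy class of `a` is recovered from `[a · b⁻¹]` and `b`. -/
theorem homotopic_trans_symm_trans (a b : Path x₀ y) :
    ((a.trans b.symm).trans b).Homotopic a := by
  rw [← Path.Homotopic.Quotient.eq]
  simp [Path.Homotopic.Quotient.mk_trans, Path.Homotopic.Quotient.mk_symm,
    Path.Homotopic.Quotient.trans_assoc]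

theorem fromPath_conj (g γ : Path x₀ x₀) :
    FundamentalGroup.fromPath (.mk ((g.trans γ).trans g.symm)) =
      (FundamentalGroup.fromPath (.mk g))⁻¹ * FundamentalGroup.fromPath (.mk γ) *
        FundamentalGroup.fromPath (.mk g) := by
  simp only [Path.Homotopic.Quotient.mk_trans, Path.Homotopic.Quotient.trans_assoc]
  rfl

namespace BasedPath

/-- A path from `x₀` as a point of `P(X, x₀)`. -/
def ofPath (a : Path x₀ y) : BasedPath X x₀ := ⟨a.toContinuousMap, a.source⟩

/-- The initial segment `s ↦ γ (t s)` of `γ`, a path from `γ 0` to `γ t`. -/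
def segment (γ : BasedPath X x₀) (t : I) : Path x₀ (γ.1 t) where
  toFun s := γ.1 (t * s)
  source' := by simp [γ.2]
  target' := by simp

@[simp]
theorem segment_apply (γ : BasedPath X x₀) (t s : I) : γ.segment t s = γ.1 (t * s) := rfl

@[simp]
theorem ofPath_segment_one (γ : BasedPath X x₀) : ofPath (γ.segment 1) = γ :=
  Subtype.ext (ContinuousMap.ext fun s => by simp [ofPath])

@[simp]
theorem ofPath_apply (a : Path x₀ y) (t : I) : (ofPath a).1 t = a t := rfl

theorem continuous_segment_family :
    Continuous fun w : (BasedPath X x₀ × I) × I => w.1.1.segment w.1.2 w.2 := by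
  simp only [segment_apply]
  fun_prop

theorem continuous_of_uncurry {ι : Type*} [TopologicalSpace ι] {f : ι → BasedPath X x₀}
    (hf : Continuous fun w : ι × I => (f w.1).1 w.2) : Continuous f :=
  Continuous.subtype_mk (ContinuousMap.continuous_of_continuous_uncurry _ hf) _

theorem continuous_ev₁ (x : X) : Continuous (ev₁ x) := by
  unfold ev₁
  fun_prop

instance : PathConnectedSpace (BasedPath X x₀) := by
  refine ⟨⟨ofPath (Path.refl x₀)⟩, fun α β => ?_⟩
  have key (γ : BasedPath X x₀) : Joined (ofPath (Path.refl x₀)) γ :=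
    ⟨⟨⟨fun t => ofPath (γ.segment t), continuous_of_uncurry
      (continuous_segment_family.comp (f := fun w : I × I => ((γ, w.1), w.2)) (by fun_prop))⟩,
      Subtype.ext (ContinuousMap.ext fun s => by simp [ofPath, γ.2]),
      ofPath_segment_one γ⟩⟩
  exact (key α).symm.trans (key β)

/-- If `ρ` is a path from `x` to `y`, then `ev₁` on `P(X, y)` is `α ↦ ρ · α` followed by `ev₁` on
`P(X, x)`. -/
theorem isQuotientMap_ev₁_of_path {x y : X} (ρ : Path x y)
    (h : Topology.IsQuotientMap (ev₁ y)) : Topology.IsQuotientMap (ev₁ x) := by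
  let f : BasedPath X y → BasedPath X x := fun α => ofPath (ρ.trans (α.segment 1))
  have hf : Continuous f := by
    refine continuous_of_uncurry ?_
    refine Path.trans_continuous_family (fun _ => ρ)
      (by exact ρ.continuous.comp continuous_snd) (fun α : BasedPath X y => α.segment 1) ?_
    exact continuous_segment_family.comp
      (f := fun w : BasedPath X y × I => ((w.1, 1), w.2)) (by fun_prop)
  refine Topology.IsQuotientMap.of_comp hf (continuous_ev₁ x) ?_
  convert! h using 1
  funext α
  simp [f, ev₁]

end BasedPath

end Paths

/-! ### Maps with the continuous path-covering property -/

/-- The path `γ` has a lift along `p` that goes from `e` to `e'`. -/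
def LiftsTo {E X : Type u} [TopologicalSpace E] [TopologicalSpace X] (p : C(E, X)) {x y : X}
    (γ : Path x y) (e e' : E) : Prop :=
  ∃ β : Path e e', ∀ t, p (β t) = γ t

namespace LiftsTo

variable {E X : Type u} [TopologicalSpace E] [TopologicalSpace X] {p : C(E, X)} {x y z : X}
  {γ : Path x y} {δ : Path y z} {e e' e'' : E}

theorem source (h : LiftsTo p γ e e') : p e = x := by
  obtain ⟨β, hβ⟩ := h
  simpa using hβ 0

theorem target (h : LiftsTo p γ e e') : p e' = y := by
  obtain ⟨β, hβ⟩ := h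
  simpa using hβ 1

theorem trans (h : LiftsTo p γ e e') (h' : LiftsTo p δ e' e'') :
    LiftsTo p (γ.trans δ) e e'' := by
  obtain ⟨β, hβ⟩ := h
  obtain ⟨β', hβ'⟩ := h'
  refine ⟨β.trans β', fun t => ?_⟩
  simp only [Path.trans_apply]
  split_ifs
  exacts [hβ _, hβ' _]

theorem symm (h : LiftsTo p γ e e') : LiftsTo p γ.symm e' e := by
  obtain ⟨β, hβ⟩ := h
  exact ⟨β.symm, fun t => hβ _⟩

theorem comp {E' : Type u} [TopologicalSpace E'] {p' : C(E', X)} {f : C(E, E')}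
    (hf : p'.comp f = p) (h : LiftsTo p γ e e') : LiftsTo p' γ (f e) (f e') := by
  obtain ⟨β, hβ⟩ := h
  exact ⟨β.map f.continuous, fun t => by rw [← hβ t, ← hf]; rfl⟩

end LiftsTo

namespace HasContinuousPathCovering

variable {E E' X : Type u} [TopologicalSpace E] [TopologicalSpace E'] [TopologicalSpace X]
  {p : C(E, X)} {p' : C(E', X)} {x y : X} {e e' e'' : E}

/-- Unique path lifting is the injectivity of `P(E, e) → P(X, p e)`. -/
theorem lift_unique (hp : HasContinuousPathCovering p) {β₁ β₂ : C(I, E)} (h0 : β₁ 0 = β₂ 0)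
    (h : ∀ t, p (β₁ t) = p (β₂ t)) : β₁ = β₂ := by
  have := (hp (β₂ 0)).injective (a₁ := ⟨β₁, h0⟩) (a₂ := ⟨β₂, rfl⟩)
    (Subtype.ext (ContinuousMap.ext h))
  exact congrArg Subtype.val this

/-- A path in a fiber is constant, as it has the same projection as a constant path. -/
theorem eq_of_joined_in_fiber (hp : HasContinuousPathCovering p) {β : C(I, E)}
    (h : ∀ t, p (β t) = x) : β 0 = β 1 := by
  have := hp.lift_unique (β₁ := β) (β₂ := ContinuousMap.const I (β 0)) rfl
    (fun t => by simp [h])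
  exact (DFunLike.congr_fun this 1).symm

/-- The endpoint of the lift starting at `e`, as a map `P(X, p e) → E`. -/
noncomputable def liftEnd (hp : HasContinuousPathCovering p) (e : E) :
    BasedPath X (p e) → E :=
  BasedPath.ev₁ e ∘ (hp e).homeomorph.symm

theorem continuous_liftEnd (hp : HasContinuousPathCovering p) (e : E) :
    Continuous (hp.liftEnd e) :=
  (BasedPath.continuous_ev₁ e).comp (hp e).homeomorph.symm.continuous

theorem isQuotientMap_liftEnd (hp : HasContinuousPathCovering p)
    (h : Topology.IsQuotientMap (BasedPath.ev₁ e)) :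
    Topology.IsQuotientMap (hp.liftEnd e) :=
  h.comp (hp e).homeomorph.symm.isQuotientMap

theorem liftEnd_eq (hp : HasContinuousPathCovering p) {γ : BasedPath X (p e)} {β : C(I, E)}
    (h0 : β 0 = e) (h : ∀ t, p (β t) = γ.1 t) : hp.liftEnd e γ = β 1 := by
  have : (hp e).homeomorph.symm γ = ⟨β, h0⟩ := by
    rw [Homeomorph.symm_apply_eq]
    exact Subtype.ext (ContinuousMap.ext fun t => (h t).symm)
  rw [liftEnd, Function.comp_apply, this]
  rfl

theorem exists_lift (hp : HasContinuousPathCovering p) (γ : BasedPath X (p e)) :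
    ∃ β : C(I, E), β 0 = e ∧ ∀ t, p (β t) = γ.1 t := by
  obtain ⟨β, hβ⟩ := (hp e).surjective γ
  exact ⟨β.1, β.2, fun t => by rw [← hβ]; rfl⟩

theorem liftsTo_liftEnd (hp : HasContinuousPathCovering p) (γ : Path (p e) y) :
    LiftsTo p γ e (hp.liftEnd e (.ofPath γ)) := by
  obtain ⟨β, h0, h⟩ := hp.exists_lift (.ofPath γ)
  exact ⟨⟨β, h0, (hp.liftEnd_eq h0 h).symm⟩, h⟩

theorem exists_liftsTo (hp : HasContinuousPathCovering p) (γ : Path x y) (h : p e = x) :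
    ∃ e', LiftsTo p γ e e' := by
  subst h
  exact ⟨_, hp.liftsTo_liftEnd γ⟩

theorem liftsTo_unique (hp : HasContinuousPathCovering p) {γ : Path x y}
    (h : LiftsTo p γ e e') (h' : LiftsTo p γ e e'') : e' = e'' := by
  obtain ⟨β, hβ⟩ := h
  obtain ⟨β', hβ'⟩ := h'
  have := hp.lift_unique (β₁ := β.toContinuousMap) (β₂ := β'.toContinuousMap)
    (β.source.trans β'.source.symm) (fun t => (hβ t).trans (hβ' t).symm)
  exact (β.target.symm.trans (DFunLike.congr_fun this 1)).trans β'.target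

/-- Homotopic paths have lifts with the same endpoint: along a homotopy, the endpoints of the lifts
form a path in a fiber. -/
theorem liftsTo_of_homotopic (hp : HasContinuousPathCovering p) {γ δ : Path x y}
    (hγδ : γ.Homotopic δ) (h : LiftsTo p γ e e') : LiftsTo p δ e e' := by
  obtain rfl := h.source
  obtain ⟨F⟩ := hγδ
  have hc : Continuous fun t => hp.liftEnd e (.ofPath (F.eval t)) :=
    (hp.continuous_liftEnd e).comp
      (BasedPath.continuous_of_uncurry (by exact F.continuous))
  have := hp.eq_of_joined_in_fiber (β := ⟨_, hc⟩) (x := y)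
    (fun t => (hp.liftsTo_liftEnd (F.eval t)).target)
  simp only [ContinuousMap.coe_mk, Path.Homotopy.eval_zero, Path.Homotopy.eval_one] at this
  rw [hp.liftsTo_unique h (hp.liftsTo_liftEnd γ), this]
  exact hp.liftsTo_liftEnd δ

/-- Maps from contractible spaces lift through a bijective map over `X`: the lift at `z` is found
by lifting the track of `z` under the contraction. -/
theorem exists_comp_eq_of_contraction (hp : HasContinuousPathCovering p)
    (hp' : HasContinuousPathCovering p') {f : C(E', E)} (hf : Function.Surjective f)
    (hpf : p.comp f = p') {Z : Type*} [TopologicalSpace Z] (c : C(Z × I, Z)) (z₀ : Z)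
    (h0 : ∀ z, c (z, 0) = z₀) (h1 : ∀ z, c (z, 1) = z) (g : C(Z, E)) :
    ∃ g' : C(Z, E'), f.comp g' = g := by
  subst hpf
  obtain ⟨e, he⟩ := hf (g z₀)
  let track : Z → BasedPath X ((p.comp f) e) := fun z =>
    ⟨⟨fun s => p (g (c (z, s))), by fun_prop⟩, by simp [h0, he]⟩
  have htrack : Continuous track :=
    BasedPath.continuous_of_uncurry (by
      exact p.continuous.comp (g.continuous.comp c.continuous))
  refine ⟨⟨_, (hp'.continuous_liftEnd e).comp htrack⟩, ContinuousMap.ext fun z => ?_⟩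
  obtain ⟨β, hβ0, hβ⟩ := hp'.exists_lift (track z)
  have key := hp.lift_unique (β₁ := f.comp β) (β₂ := ⟨fun s => g (c (z, s)), by fun_prop⟩)
    (by simp [hβ0, he, h0]) hβ
  have := DFunLike.congr_fun key 1
  simp only [ContinuousMap.coe_mk, h1, ContinuousMap.comp_apply] at this
  simp [hp'.liftEnd_eq hβ0 hβ, this]

/-- Cubes, and cylinders over cubes, are contractible, so spheroids and their homotopies lift through
`f`. -/
theorem isWeakHomotopyEquiv_of_bijective [PathConnectedSpace E] [PathConnectedSpace E']
    (hp : HasContinuousPathCovering p) (hp' : HasContinuousPathCovering p') {f : C(E', E)}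
    (hf : Function.Bijective f) (hpf : p.comp f = p') : IsWeakHomotopyEquiv f := by
  refine ⟨?_, fun n _ e => ⟨?_, ?_⟩⟩
  · have h1 := pathConnectedSpace_iff_zerothHomotopy.1 ‹PathConnectedSpace E›
    have h2 := pathConnectedSpace_iff_zerothHomotopy.1 ‹PathConnectedSpace E'›
    obtain ⟨_, _⟩ := h1
    obtain ⟨⟨a⟩, _⟩ := h2
    exact ⟨Function.injective_of_subsingleton _,
      fun b => ⟨a, Subsingleton.elim _ _⟩⟩
  · rintro ⟨a⟩ ⟨b⟩ hab
    obtain ⟨F⟩ := Quotient.exact hab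
    obtain ⟨F', hF'⟩ := hp.exists_comp_eq_of_contraction hp' hf.surjective hpf
      (Z := I × (Fin n → I))
      ⟨fun w => (w.2 * w.1.1, fun i => w.2 * w.1.2 i), by fun_prop⟩ (0, 0)
      (fun z => by simp; rfl) (fun z => by simp) F.toContinuousMap
    have hF (w) : f (F' w) = F w := DFunLike.congr_fun hF' w
    refine Quotient.sound ⟨⟨⟨F', fun z => hf.injective ?_, fun z => hf.injective ?_⟩, ?_⟩⟩
    · exact (hF _).trans (F.apply_zero z)
    · exact (hF _).trans (F.apply_one z)
    · intro t z hz
      exact hf.injective ((hF _).trans (F.eq_fst t hz))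
  · rintro ⟨g⟩
    obtain ⟨g', hg'⟩ := hp.exists_comp_eq_of_contraction hp' hf.surjective hpf
      (Z := Fin n → I) ⟨fun w i => w.2 * w.1 i, by fun_prop⟩ 0
      (fun z => by simp; rfl) (fun z => by simp) g.1
    have hg (w) : f (g' w) = g w := DFunLike.congr_fun hg' w
    refine ⟨Quotient.mk _ ⟨g', fun z hz => hf.injective ((hg z).trans (g.2 z hz))⟩, ?_⟩
    exact congrArg (Quotient.mk _) (Subtype.ext hg')

end HasContinuousPathCovering

/-! ### Subgroups and changes of base point -/

namespace ContPathCovering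

variable {X : Type u} [TopologicalSpace X] {x₀ : X} {P P₁ P₂ : ContPathCovering X}
  {H K H₁ H₂ : Subgroup (FundamentalGroup X x₀)}

/-- The subgroup that corresponds to a based map consists of the classes of the loops with closed
lifts. -/
theorem corresponds_iff {e₀ : P.E} :
    P.Corresponds e₀ H ↔ P.p e₀ = x₀ ∧
      ∀ γ : Path x₀ x₀, FundamentalGroup.fromPath (.mk γ) ∈ H ↔ LiftsTo P.p γ e₀ e₀ := by
  have key : ∀ (h : P.p e₀ = x₀) (γ : Path x₀ x₀),
      FundamentalGroup.fromPath (.mk γ) ∈ (FundamentalGroup.mapOfEq P.p h).range ↔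
        LiftsTo P.p γ e₀ e₀ := by
    rintro rfl γ
    simp only [MonoidHom.mem_range, FundamentalGroup.mapOfEq_apply,
      Path.Homotopic.Quotient.cast_rfl_rfl]
    constructor
    · rintro ⟨⟨β⟩, hβ⟩
      exact P.covering.liftsTo_of_homotopic (Path.Homotopic.Quotient.exact hβ) ⟨β, fun t => rfl⟩
    · rintro ⟨β, hβ⟩
      refine ⟨FundamentalGroup.fromPath (.mk β), ?_⟩
      have : β.map P.p.continuous = γ := Path.ext (funext hβ)
      rw [← Path.Homotopic.Quotient.mk_map, this]
  constructor
  · rintro ⟨h, rfl⟩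
    exact ⟨h, key h⟩
  · rintro ⟨h, hH⟩
    refine ⟨h, Subgroup.ext ?_⟩
    rintro ⟨γ⟩
    exact (key h γ).trans (hH γ).symm

theorem Corresponds.unique {e₀ : P.E} (h : P.Corresponds e₀ H) (h' : P.Corresponds e₀ K) :
    H = K := by
  obtain ⟨_, rfl⟩ := h
  obtain ⟨_, rfl⟩ := h'
  rfl

/-- Lifting a loop `g` changes the base point of the total space within a fiber, and conjugates the
subgroup by `[g]`. -/
theorem Corresponds.conj {e e' : P.E} (h : P.Corresponds e H) {g : Path x₀ x₀}
    (hg : LiftsTo P.p g e e') :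
    P.Corresponds e' (H.map (MulAut.conj (FundamentalGroup.fromPath (.mk g))).toMonoidHom) := by
  rw [corresponds_iff] at h ⊢
  refine ⟨hg.target, fun γ => ?_⟩
  rw [Subgroup.mem_map_equiv, MulAut.conj_symm_apply, ← fromPath_conj, h.2]
  refine ⟨fun hl => ?_, fun hl => (hg.trans hl).trans hg.symm⟩
  obtain ⟨e'', he''⟩ := P.covering.exists_liftsTo γ hg.target
  rwa [← P.covering.liftsTo_unique ((hg.symm.trans hl).trans hg)
    (P.covering.liftsTo_of_homotopic ?_ he'')] at he''
  rw [← Path.Homotopic.Quotient.eq]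
  have hc : (Path.Homotopic.Quotient.symm (.mk g)).trans ((Path.Homotopic.Quotient.mk g).trans
      (.mk γ)) = .mk γ := by
    rw [← Path.Homotopic.Quotient.trans_assoc]
    simp
  simp only [Path.Homotopic.Quotient.mk_trans, Path.Homotopic.Quotient.mk_symm,
    Path.Homotopic.Quotient.trans_assoc, Path.Homotopic.Quotient.symm_trans,
    Path.Homotopic.Quotient.trans_refl, hc]

theorem Corresponds.areConjugate {e e' : P.E} (h : P.Corresponds e H) (h' : P.Corresponds e' K) :
    AreConjugate H K := by
  obtain ⟨ρ⟩ := PathConnectedSpace.joined e e'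
  have hρ : LiftsTo P.p ((ρ.map P.p.continuous).cast h.1.symm h'.1.symm) e e' :=
    ⟨ρ, fun t => rfl⟩
  exact ⟨_, (h.conj hρ).unique h'⟩

theorem Corresponds.exists_of_areConjugate {e : P.E} (h : P.Corresponds e H)
    (hHK : AreConjugate H K) : ∃ e' : P.E, P.Corresponds e' K := by
  obtain ⟨⟨g⟩, rfl⟩ := hHK
  obtain ⟨e', he'⟩ := P.covering.exists_liftsTo g h.1
  exact ⟨e', h.conj he'⟩

/-- An injective map over `X` preserves the subgroup, because it reflects whether a lift closes. -/
theorem corresponds_comp_iff {f : C(P₁.E, P₂.E)} (hf : Function.Injective f)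
    (hpf : P₂.p.comp f = P₁.p) {e : P₁.E} :
    P₂.Corresponds (f e) H ↔ P₁.Corresponds e H := by
  rw [corresponds_iff, corresponds_iff, ← hpf, ContinuousMap.comp_apply, hpf]
  refine and_congr_right fun he => forall_congr' fun γ => iff_congr Iff.rfl
    ⟨fun h => ?_, fun h => h.comp hpf⟩
  obtain ⟨e', he'⟩ := P₁.covering.exists_liftsTo (e := e) γ (by rw [← hpf]; exact he)
  rwa [← hf (P₂.covering.liftsTo_unique h (he'.comp hpf))] at he'

theorem WeaklyEquivalent.exists_corresponds (h : P₁.WeaklyEquivalent P₂) {e₁ : P₁.E}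
    (h₁ : P₁.Corresponds e₁ H) : ∃ e₂ : P₂.E, P₂.Corresponds e₂ H := by
  induction h with
  | refl => exact ⟨e₁, h₁⟩
  | tail _ hs ih =>
    obtain ⟨e, he⟩ := ih
    obtain ⟨P₃, f₁, f₂, ⟨hf₁, _, hp₁⟩, hf₂, _, hp₂⟩ := hs
    obtain ⟨e₃, rfl⟩ := hf₁.surjective e
    exact ⟨f₂ e₃, (corresponds_comp_iff hf₂.injective hp₂).2
      ((corresponds_comp_iff hf₁.injective hp₁).1 he)⟩

theorem Equivalent.exists_corresponds (h : P₁.Equivalent P₂) {e₁ : P₁.E}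
    (h₁ : P₁.Corresponds e₁ H) : ∃ e₂ : P₂.E, P₂.Corresponds e₂ H := by
  obtain ⟨h, hp⟩ := h
  exact ⟨h e₁, (corresponds_comp_iff (f := ⟨h, h.continuous⟩) h.injective
    (ContinuousMap.ext hp)).2 h₁⟩

/-- Two paths from `x₀` have lifts at `e₀` with the same endpoint iff they differ by an element
of `H`. -/
theorem Corresponds.loopClass_mem_iff {e₀ e e' : P.E} (h : P.Corresponds e₀ H) {y : X}
    {a b : Path x₀ y} (ha : LiftsTo P.p a e₀ e) (hb : LiftsTo P.p b e₀ e') :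
    loopClass a b ∈ H ↔ e = e' := by
  rw [loopClass, (corresponds_iff.1 h).2]
  constructor
  · intro hl
    exact P.covering.liftsTo_unique ha
      (P.covering.liftsTo_of_homotopic (homotopic_trans_symm_trans a b) (hl.trans hb))
  · rintro rfl
    exact ha.trans hb.symm

/-- The map `π₁(X, x₀) ⧸ H → E` that lifts loops and takes endpoints is continuous, injective and
has its image in a fiber. -/
theorem Corresponds.totallyPathDisconnected {e₀ : P.E} (h : P.Corresponds e₀ H) :
    TotallyPathDisconnected (FundamentalGroup X x₀ ⧸ H) := by
  obtain rfl := h.1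
  have hmem (γ δ : Path (P.p e₀) (P.p e₀)) :
      (FundamentalGroup.fromPath (.mk γ))⁻¹ * FundamentalGroup.fromPath (.mk δ) ∈ H ↔
        P.covering.liftEnd e₀ (.ofPath δ) = P.covering.liftEnd e₀ (.ofPath γ) :=
    h.loopClass_mem_iff (P.covering.liftsTo_liftEnd δ) (P.covering.liftsTo_liftEnd γ)
  let F₀ : FundamentalGroup X (P.p e₀) → P.E :=
    Quotient.lift (fun γ : Path (P.p e₀) (P.p e₀) => P.covering.liftEnd e₀ (.ofPath γ))
      fun γ δ hγδ => P.covering.liftsTo_unique (P.covering.liftsTo_liftEnd γ)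
        (P.covering.liftsTo_of_homotopic (Path.Homotopic.symm hγδ) (P.covering.liftsTo_liftEnd δ))
  have hF₀ : Continuous F₀ := by
    refine continuous_coinduced_dom.2 ((P.covering.continuous_liftEnd e₀).comp
      (BasedPath.continuous_of_uncurry ?_))
    exact continuous_eval
  let F : FundamentalGroup X (P.p e₀) ⧸ H → P.E := Quotient.lift F₀ (by
    rintro ⟨γ⟩ ⟨δ⟩ hγδ
    exact ((hmem γ δ).1 (QuotientGroup.leftRel_apply.1 hγδ)).symm)
  have hF : Continuous F := hF₀.quotient_lift _
  have hFp (c) : P.p (F c) = P.p e₀ := by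
    obtain ⟨⟨γ⟩⟩ := c
    exact (P.covering.liftsTo_liftEnd γ).target
  have hFi : Function.Injective F := by
    rintro ⟨⟨γ⟩⟩ ⟨⟨δ⟩⟩ hγδ
    exact QuotientGroup.eq.2 ((hmem γ δ).2 (Eq.symm hγδ))
  rintro c d ⟨ω⟩
  refine hFi ?_
  have := P.covering.eq_of_joined_in_fiber (β := ⟨fun t => F (ω t), by fun_prop⟩)
    (fun t => hFp (ω t))
  simpa only [ContinuousMap.coe_mk, Path.source, Path.target] using this

/-- As the total space is path-connected, `ev₁` is a quotient map for all base points or for none. -/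
theorem isQuotientMap_ev₁ {e : P.E} (h : Topology.IsQuotientMap (BasedPath.ev₁ e))
    (e' : P.E) : Topology.IsQuotientMap (BasedPath.ev₁ e') :=
  BasedPath.isQuotientMap_ev₁_of_path (PathConnectedSpace.somePath e' e) h

end ContPathCovering

/-! ### The quotient of the path space determined by a subgroup -/

theorem Topology.IsQuotientMap.restrictPreimage_isClosed {Y Z : Type*} [TopologicalSpace Y]
    [TopologicalSpace Z] {f : Y → Z} (hf : Topology.IsQuotientMap f) {s : Set Z}
    (hs : IsClosed s) : Topology.IsQuotientMap (s.restrictPreimage f) := by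
  refine Topology.isQuotientMap_iff_isClosed.2
    ⟨hf.surjective.restrictPreimage _, fun U => ⟨fun h => h.preimage ?_, fun h => ?_⟩⟩
  · exact hf.continuous.restrictPreimage
  · have h' := (hs.preimage hf.continuous).isClosedEmbedding_subtypeVal.isClosedMap _ h
    have : Subtype.val '' (s.restrictPreimage f ⁻¹' U) = f ⁻¹' (Subtype.val '' U) := by
      ext y
      constructor
      · rintro ⟨w, hw, rfl⟩
        exact ⟨_, hw, rfl⟩
      · rintro ⟨⟨z, hz⟩, hU, hw⟩
        dsimp at hw
        subst hw
        exact ⟨⟨y, hz⟩, hU, rfl⟩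
    rw [this, (Topology.isQuotientMap_iff_isClosed.1 hf).2 _ |>.symm] at h'
    exact (hs.isClosedEmbedding_subtypeVal.isClosed_iff_image_isClosed).2 h'

/-- The currying argument behind `continuous_lift_prod_left`, for the map `id` into the coinduced
topology. -/
theorem Topology.IsQuotientMap.prodMap_id {Y Z W : Type*} [TopologicalSpace Y]
    [TopologicalSpace Z] [TopologicalSpace W] [LocallyCompactSpace W] {f : Y → Z}
    (hf : Topology.IsQuotientMap f) : Topology.IsQuotientMap (Prod.map f (id : W → W)) := by
  refine ⟨⟨le_antisymm ?_ ?_⟩, hf.surjective.prodMap Function.surjective_id⟩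
  · let t : TopologicalSpace (Z × W) := .coinduced (Prod.map f id) inferInstance
    exact continuous_id_iff_le.1 (@Topology.IsQuotientMap.continuous_lift_prod_left _ _ _ _ _ _ _ t
      _ f hf id continuous_coinduced_rng)
  · exact (hf.continuous.prodMap continuous_id).coinduced_le

section PathSpaceQuotient

variable {X : Type u} [TopologicalSpace X] {x₀ : X}

/-- Two paths from `x₀` are related if they have the same endpoint and differ by an element
of `H`. -/
def pathSetoidOfSubgroup (H : Subgroup (FundamentalGroup X x₀)) : Setoid (BasedPath X x₀) where
  r α β := ∃ (y : X) (a b : Path x₀ y), BasedPath.ofPath a = α ∧ BasedPath.ofPath b = β ∧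
    loopClass a b ∈ H
  iseqv := by
    have inj {y : X} (a b : Path x₀ y) (h : BasedPath.ofPath a = .ofPath b) : a = b :=
      Path.ext (congrArg (fun α : BasedPath X x₀ => ⇑α.1) h)
    refine ⟨fun α => ⟨_, α.segment 1, α.segment 1, by simp, by simp,
      (loopClass_self (α.segment 1)).symm ▸ H.one_mem⟩, ?_, ?_⟩
    · rintro _ _ ⟨y, a, b, rfl, rfl, h⟩
      exact ⟨y, b, a, rfl, rfl, by rwa [← loopClass_inv, inv_mem_iff]⟩
    · rintro _ _ _ ⟨y, a, b, rfl, rfl, h⟩ ⟨y', b', c, hb, rfl, h'⟩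
      obtain rfl : y' = y := by
        have := congrArg (fun α : BasedPath X x₀ => α.1 1) hb
        simpa using this
      obtain rfl := inj _ _ hb
      exact ⟨y', a, c, rfl, rfl, by rw [← loopClass_mul a b' c]; exact mul_mem h' h⟩

/-- The quotient of `P(X, x₀)` that identifies paths with the same endpoint that differ by an
element of `H`, with the quotient topology. -/
abbrev PathSpaceQuotient (H : Subgroup (FundamentalGroup X x₀)) : Type u :=
  Quotient (pathSetoidOfSubgroup H)

namespace PathSpaceQuotient

variable (H : Subgroup (FundamentalGroup X x₀)) {y z : X}

/-- The point of the quotient represented by a path. -/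
def mk (a : Path x₀ y) : PathSpaceQuotient H := Quotient.mk _ (BasedPath.ofPath a)

/-- The endpoint projection of the quotient onto `X`. -/
def endpoint : C(PathSpaceQuotient H, X) where
  toFun := Quotient.lift (BasedPath.ev₁ x₀) (by
    rintro _ _ ⟨y, a, b, rfl, rfl, h⟩
    simp [BasedPath.ev₁])
  continuous_toFun := (BasedPath.continuous_ev₁ x₀).quotient_lift _

@[simp]
theorem endpoint_mk (a : Path x₀ y) : endpoint H (mk H a) = y := a.target

variable {H}

theorem mk_eq_mk {a b : Path x₀ y} : mk H a = mk H b ↔ loopClass a b ∈ H := by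
  refine ⟨fun h => ?_, fun h => Quotient.sound ⟨y, a, b, rfl, rfl, h⟩⟩
  obtain ⟨y', a', b', ha, hb, hab⟩ := Quotient.exact h
  obtain rfl : y' = y := by
    have := congrArg (fun α : BasedPath X x₀ => α.1 1) ha
    simpa using this
  obtain rfl : a' = a := Path.ext (congrArg (fun α : BasedPath X x₀ => ⇑α.1) ha)
  obtain rfl : b' = b := Path.ext (congrArg (fun α : BasedPath X x₀ => ⇑α.1) hb)
  exact hab

theorem mk_congr {a b : Path x₀ y} (h : a.Homotopic b) : mk H a = mk H b := by
  have : loopClass a b = loopClass b b := by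
    simp only [loopClass, Path.Homotopic.Quotient.mk_trans, Path.Homotopic.Quotient.eq.2 h]
  rw [mk_eq_mk, this, loopClass_self]
  exact H.one_mem

theorem mk_trans_const (a : Path x₀ y) (c : Path y z) (hc : ∀ t, c t = y) :
    mk H (a.trans c) = mk H a := by
  obtain rfl : y = z := (hc 1).symm.trans c.target
  obtain rfl : c = Path.refl y := Path.ext (funext hc)
  exact mk_congr ⟨Path.Homotopy.transRefl a⟩

theorem mk_segment_one (α : BasedPath X x₀) : mk H (α.segment 1) = Quotient.mk _ α := by
  rw [mk, BasedPath.ofPath_segment_one]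

theorem exists_mk_eq (e : PathSpaceQuotient H) (h : endpoint H e = y) :
    ∃ a : Path x₀ y, mk H a = e := by
  subst h
  obtain ⟨α⟩ := e
  exact ⟨α.segment 1, mk_segment_one α⟩

/-- The path `t ↦ [a · γ_t]` in the quotient, where `γ_t` is the initial segment of `γ`, as a
function of `γ`. -/
noncomputable def lift (a : Path x₀ y) (γ : BasedPath X y) :
    BasedPath (PathSpaceQuotient H) (mk H a) :=
  ⟨⟨fun t => mk H (a.trans (γ.segment t)), by
    refine continuous_quotient_mk'.comp (BasedPath.continuous_of_uncurry ?_)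
    refine Path.trans_continuous_family (fun _ => a)
      (by exact a.continuous.comp continuous_snd) (fun t => γ.segment t) ?_
    exact BasedPath.continuous_segment_family.comp
      (f := fun w : I × I => ((γ, w.1), w.2)) (by fun_prop)⟩,
    mk_trans_const _ _ (by simp [γ.2])⟩

theorem continuous_lift (a : Path x₀ y) : Continuous (lift (H := H) a) := by
  refine BasedPath.continuous_of_uncurry (continuous_quotient_mk'.comp
    (BasedPath.continuous_of_uncurry ?_))
  exact Path.trans_continuous_family (fun _ : BasedPath X y × I => a)
    (by exact a.continuous.comp continuous_snd) (fun w => w.1.segment w.2)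
    BasedPath.continuous_segment_family

/-- The endpoint of the lift of `γ` at the base point is the class of `γ`. -/
theorem lift_refl_one (γ : BasedPath X x₀) :
    (lift (H := H) (Path.refl x₀) γ).1 1 = Quotient.mk _ γ := by
  change mk H ((Path.refl x₀).trans (γ.segment 1)) = _
  rw [mk_congr ⟨Path.Homotopy.reflTrans _⟩, mk_segment_one]

/-- The quotient map from `P(X, x₀)` factors through `ev₁`, by `lift_refl_one`. -/
theorem isQuotientMap_ev₁ :
    Topology.IsQuotientMap (BasedPath.ev₁ (mk H (Path.refl x₀))) := by
  refine .of_comp (continuous_lift _) (BasedPath.continuous_ev₁ _) ?_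
  convert! isQuotientMap_quotient_mk' (s := pathSetoidOfSubgroup H) using 1
  exact funext lift_refl_one

/-- Unique path lifting for the quotient. For a path `β` in the quotient over `γ`, the class
`[b · γ_t⁻¹ · a⁻¹]`, where `b` represents `β t`, is a continuous function of `t` with values in
`π₁(X, x₀) ⧸ H`, and is therefore constant. Continuity can be checked on representatives because
`P(X, x₀) × I → E × I` is a quotient map, and stays one over the closed subset of all `(e, t)` such
that `e` lies over `γ t`. -/
theorem eq_mk_trans_segment [T2Space X] (hH : TotallyPathDisconnected (FundamentalGroup X x₀ ⧸ H))
    (a : Path x₀ y) (γ : BasedPath X y) (β : C(I, PathSpaceQuotient H)) (h0 : β 0 = mk H a)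
    (hβ : ∀ t, endpoint H (β t) = γ.1 t) (t : I) : β t = mk H (a.trans (γ.segment t)) := by
  let q : BasedPath X x₀ × I → PathSpaceQuotient H × I := Prod.map (Quotient.mk _) id
  let s : Set (PathSpaceQuotient H × I) := {w | endpoint H w.1 = γ.1 w.2}
  have hs : IsClosed s := isClosed_eq (by fun_prop) (by fun_prop)
  have hq : Topology.IsQuotientMap (s.restrictPreimage q) :=
    (isQuotientMap_quotient_mk'.prodMap_id).restrictPreimage_isClosed hs
  let rep (w : q ⁻¹' s) : Path x₀ (γ.1 w.1.2) := (w.1.1.segment 1).cast rfl w.2.symm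
  have hrep (w : q ⁻¹' s) : mk H (rep w) = (q w.1).1 := mk_segment_one w.1.1
  let φ (w : q ⁻¹' s) : FundamentalGroup X x₀ ⧸ H :=
    QuotientGroup.mk (loopClass (rep w) (a.trans (γ.segment w.1.2)))
  have hφ : Continuous φ := by
    refine continuous_quotient_mk'.comp (continuous_coinduced_rng.comp
      (g := fun δ : Path x₀ x₀ => FundamentalGroup.fromPath (.mk δ))
      (f := fun w : q ⁻¹' s => (rep w).trans (a.trans (γ.segment w.1.2)).symm) ?_)
    refine Path.continuous_uncurry_iff.1 ?_
    refine Path.trans_continuous_family rep ?_ _ (Path.symm_continuous_family _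
      (Path.trans_continuous_family (fun _ => a) ?_ (fun w : q ⁻¹' s => γ.segment w.1.2) ?_))
    · exact BasedPath.continuous_segment_family.comp
        (f := fun w : (q ⁻¹' s) × I => ((w.1.1.1, 1), w.2)) (by fun_prop)
    · exact a.continuous.comp continuous_snd
    · exact BasedPath.continuous_segment_family.comp
        (f := fun w : (q ⁻¹' s) × I => ((γ, w.1.1.2), w.2)) (by fun_prop)
  have hφq (w w' : q ⁻¹' s) (h : s.restrictPreimage q w = s.restrictPreimage q w') :
      φ w = φ w' := by
    obtain ⟨⟨α, r⟩, hw⟩ := w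
    obtain ⟨⟨α', r'⟩, hw'⟩ := w'
    have h1 : q (α, r) = q (α', r') := congrArg Subtype.val h
    obtain rfl : r = r' := congrArg Prod.snd h1
    refine QuotientGroup.eq.2 ?_
    have h2 : loopClass (y := γ.1 r) (rep ⟨(α', r), hw'⟩) (rep ⟨(α, r), hw⟩) ∈ H :=
      mk_eq_mk.1 (by rw [hrep, hrep, h1])
    rw [loopClass_inv]
    rwa [← loopClass_mul _ (a.trans (γ.segment r))] at h2
  have hφ_one (w : q ⁻¹' s) (h : (q w.1).1 = mk H (a.trans (γ.segment w.1.2))) :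
      φ w = QuotientGroup.mk 1 := by
    -- `QuotientGroup.eq` compares `u` and `1` by `u⁻¹ * 1`.
    rw [← hrep, mk_eq_mk, ← inv_mem_iff, ← mul_one (loopClass _ _)⁻¹] at h
    exact QuotientGroup.eq.2 h
  have hφ_one' (w : q ⁻¹' s) (h : φ w = QuotientGroup.mk 1) :
      (q w.1).1 = mk H (a.trans (γ.segment w.1.2)) := by
    have := QuotientGroup.eq.1 h
    rwa [mul_one, inv_mem_iff, ← mk_eq_mk, hrep] at this
  let ψ : s → FundamentalGroup X x₀ ⧸ H := φ ∘ Function.surjInv hq.surjective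
  have hψ (w) : ψ (s.restrictPreimage q w) = φ w := hφq _ _ (Function.surjInv_eq hq.surjective _)
  have hψc : Continuous ψ := hq.continuous_iff.2 (hφ.congr fun w => (hψ w).symm)
  let track : I → s := fun r => ⟨(β r, r), hβ r⟩
  have htrack : Continuous track := by fun_prop
  have hconst : ψ (track 0) = ψ (track t) :=
    hH _ _ ⟨⟨⟨fun r => ψ (track (t * r)), by fun_prop⟩, by simp, by simp⟩⟩
  obtain ⟨w₀, hw₀⟩ := hq.surjective (track 0)
  obtain ⟨w, hw⟩ := hq.surjective (track t)
  have hw₀1 : q w₀.1 = (β 0, 0) := congrArg Subtype.val hw₀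
  have hw1 : q w.1 = (β t, t) := congrArg Subtype.val hw
  have hw₀2 : w₀.1.2 = 0 := congrArg Prod.snd hw₀1
  have hw2 : w.1.2 = t := congrArg Prod.snd hw1
  rw [← hw₀, ← hw, hψ, hψ, hφ_one w₀] at hconst
  · have := hφ_one' w hconst.symm
    rwa [hw1, hw2] at this
  · rw [hw₀1, mk_trans_const _ _ fun r => by simp [hw₀2, γ.2], h0]

/-- The map `lift` is a continuous section of `P(E, e) → P(X, p e)`; unique path lifting makes it an
inverse. -/
theorem hasContinuousPathCovering [T2Space X]
    (hH : TotallyPathDisconnected (FundamentalGroup X x₀ ⧸ H)) :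
    HasContinuousPathCovering (endpoint H) := by
  intro e
  obtain ⟨a, ha⟩ := exists_mk_eq e rfl
  let g (γ : BasedPath X (endpoint H e)) : BasedPath (PathSpaceQuotient H) e :=
    ⟨(lift a γ).1, (lift a γ).2.trans ha⟩
  have hg : Continuous g := Continuous.subtype_mk (continuous_subtype_val.comp (continuous_lift a)) _
  have hpg (γ) : BasedPath.map (endpoint H) e (g γ) = γ :=
    Subtype.ext (ContinuousMap.ext fun t => endpoint_mk H (a.trans (γ.segment t)))
  have hgp (β) : g (BasedPath.map (endpoint H) e β) = β :=
    Subtype.ext (ContinuousMap.ext fun t => (eq_mk_trans_segment hH a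
      (BasedPath.map (endpoint H) e β) β.1 (β.2.trans ha.symm) (fun _ => rfl) t).symm)
  refine (Homeomorph.mk ⟨BasedPath.map (endpoint H) e, g, hgp, hpg⟩ ?_ hg).isHomeomorph
  exact Continuous.subtype_mk (by fun_prop) _

/-- The quotient of the path space as a map over `X` with the continuous path-covering property. -/
noncomputable def contPathCovering [T2Space X] [PathConnectedSpace X]
    (hH : TotallyPathDisconnected (FundamentalGroup X x₀ ⧸ H)) : ContPathCovering X where
  E := PathSpaceQuotient H
  p := endpoint H
  covering := hasContinuousPathCovering hH

theorem corresponds_contPathCovering [T2Space X] [PathConnectedSpace X]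
    (hH : TotallyPathDisconnected (FundamentalGroup X x₀ ⧸ H)) :
    (contPathCovering hH).Corresponds (mk H (Path.refl x₀)) H := by
  refine ContPathCovering.corresponds_iff.2 ⟨endpoint_mk H _, fun γ => ?_⟩
  have hγ : LiftsTo (contPathCovering hH).p γ (mk H (Path.refl x₀)) (mk H γ) :=
    ⟨⟨(lift (Path.refl x₀) (.ofPath γ)).1, (lift (Path.refl x₀) (.ofPath γ)).2,
      lift_refl_one (.ofPath γ)⟩, fun t => endpoint_mk H _⟩
  rw [← loopClass_refl_right, ← mk_eq_mk]
  refine ⟨fun h => h ▸ hγ, fun h => (contPathCovering hH).covering.liftsTo_unique hγ h⟩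

/-- The quotient of the path space maps bijectively, over `X`, onto every total space that
corresponds to the same subgroup: the map lifts paths and takes endpoints. If `ev₁` is a quotient
map, then so is this bijection. -/
theorem exists_bijective_map [T2Space X] [PathConnectedSpace X]
    (hH : TotallyPathDisconnected (FundamentalGroup X x₀ ⧸ H)) {P : ContPathCovering X} {e₀ : P.E}
    (h : P.Corresponds e₀ H) :
    ∃ f : C((contPathCovering hH).E, P.E), Function.Bijective f ∧
      P.p.comp f = (contPathCovering hH).p ∧
      (Topology.IsQuotientMap (BasedPath.ev₁ e₀) → IsHomeomorph f) := by
  obtain rfl := h.1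
  have hL {y : X} (a b : Path (P.p e₀) y) : loopClass a b ∈ H ↔
      P.covering.liftEnd e₀ (.ofPath a) = P.covering.liftEnd e₀ (.ofPath b) :=
    h.loopClass_mem_iff (P.covering.liftsTo_liftEnd a) (P.covering.liftsTo_liftEnd b)
  let F : PathSpaceQuotient H → P.E := Quotient.lift (P.covering.liftEnd e₀) (by
    rintro _ _ ⟨y, a, b, rfl, rfl, hab⟩
    exact (hL a b).1 hab)
  have hF : Continuous F := (P.covering.continuous_liftEnd e₀).quotient_lift _
  have hFp (e) : P.p (F e) = endpoint H e := by
    obtain ⟨y, hy⟩ : ∃ y, endpoint H e = y := ⟨_, rfl⟩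
    obtain ⟨a, rfl⟩ := exists_mk_eq e hy
    exact (P.covering.liftsTo_liftEnd a).target.trans (endpoint_mk H a).symm
  have hFi : Function.Injective F := by
    intro e e' hee'
    obtain ⟨y, hy⟩ : ∃ y, endpoint H e' = y := ⟨_, rfl⟩
    obtain ⟨a, rfl⟩ := exists_mk_eq e (by rw [← hFp, hee', hFp, hy])
    obtain ⟨b, rfl⟩ := exists_mk_eq e' hy
    exact mk_eq_mk.2 ((hL a b).2 hee')
  have hFs : Function.Surjective F := by
    intro e
    let ρ := PathConnectedSpace.somePath e₀ e
    refine ⟨mk H (ρ.map P.p.continuous), ?_⟩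
    exact P.covering.liftsTo_unique (P.covering.liftsTo_liftEnd _) ⟨ρ, fun _ => rfl⟩
  refine ⟨⟨F, hF⟩, ⟨hFi, hFs⟩, ContinuousMap.ext hFp, fun hq => ?_⟩
  refine isHomeomorph_iff_isQuotientMap_injective.2 ⟨?_, hFi⟩
  exact .of_comp continuous_quotient_mk' hF (P.covering.isQuotientMap_liftEnd hq)

end PathSpaceQuotient

end PathSpaceQuotient

/-! ### The classification -/

namespace ContPathCovering

variable {X : Type u} [TopologicalSpace X] [T2Space X] [PathConnectedSpace X] {x₀ : X}
  {P₁ P₂ : ContPathCovering X} {H : Subgroup (FundamentalGroup X x₀)} {e₁ : P₁.E} {e₂ : P₂.E}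

/-- The quotient of the path space is the middle term of a simple weak equivalence. -/
theorem Corresponds.weaklyEquivalent (h₁ : P₁.Corresponds e₁ H) (h₂ : P₂.Corresponds e₂ H) :
    P₁.WeaklyEquivalent P₂ := by
  have hH := h₁.totallyPathDisconnected
  obtain ⟨f₁, hf₁, hp₁, -⟩ := PathSpaceQuotient.exists_bijective_map hH h₁
  obtain ⟨f₂, hf₂, hp₂, -⟩ := PathSpaceQuotient.exists_bijective_map hH h₂
  have hP := (PathSpaceQuotient.contPathCovering hH).covering
  exact .single ⟨_, f₁, f₂, ⟨hf₁, P₁.covering.isWeakHomotopyEquiv_of_bijective hP hf₁ hp₁, hp₁⟩,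
    hf₂, P₂.covering.isWeakHomotopyEquiv_of_bijective hP hf₂ hp₂, hp₂⟩

/-- Both total spaces are homeomorphic over `X` to the quotient of the path space. -/
theorem Corresponds.equivalent (hq₁ : Topology.IsQuotientMap (BasedPath.ev₁ e₁))
    (hq₂ : Topology.IsQuotientMap (BasedPath.ev₁ e₂)) (h₁ : P₁.Corresponds e₁ H)
    (h₂ : P₂.Corresponds e₂ H) : P₁.Equivalent P₂ := by
  have hH := h₁.totallyPathDisconnected
  obtain ⟨f₁, -, hp₁, hf₁⟩ := PathSpaceQuotient.exists_bijective_map hH h₁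
  obtain ⟨f₂, -, hp₂, hf₂⟩ := PathSpaceQuotient.exists_bijective_map hH h₂
  let g₁ := (hf₁ hq₁).homeomorph
  refine ⟨g₁.symm.trans (hf₂ hq₂).homeomorph, fun e => ?_⟩
  obtain ⟨e, rfl⟩ := g₁.surjective e
  have h1 : P₁.p (g₁ e) = _ := DFunLike.congr_fun hp₁ e
  have h2 : P₂.p (f₂ e) = _ := DFunLike.congr_fun hp₂ e
  simp [h1, h2]

end ContPathCovering

theorem theorem1p2 (X : Type u) [TopologicalSpace X] [T2Space X] [PathConnectedSpace X] (x₀ : X) :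
    -- existence and uniqueness up to weak equivalence for a given subgroup
    (∀ H : Subgroup (FundamentalGroup X x₀),
      ((∃ (P : ContPathCovering X) (e₀ : P.E), P.Corresponds e₀ H) ↔
        TotallyPathDisconnected (FundamentalGroup X x₀ ⧸ H)) ∧
      (∀ (P₁ P₂ : ContPathCovering X) (e₁ : P₁.E) (e₂ : P₂.E),
        P₁.Corresponds e₁ H → P₂.Corresponds e₂ H → P₁.WeaklyEquivalent P₂)) ∧
    -- weak equivalence classes correspond to conjugacy classes of subgroups
    (∀ (P₁ P₂ : ContPathCovering X) (e₁ : P₁.E) (e₂ : P₂.E)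
      (H₁ H₂ : Subgroup (FundamentalGroup X x₀)),
      P₁.Corresponds e₁ H₁ → P₂.Corresponds e₂ H₂ →
        (P₁.WeaklyEquivalent P₂ ↔ AreConjugate H₁ H₂)) ∧
    -- (1) the classification up to equivalence of the maps for which `ev₁` is quotient
    (∀ H : Subgroup (FundamentalGroup X x₀),
      ((∃ (P : ContPathCovering X) (e₀ : P.E),
          Topology.IsQuotientMap (BasedPath.ev₁ e₀) ∧ P.Corresponds e₀ H) ↔
        TotallyPathDisconnected (FundamentalGroup X x₀ ⧸ H)) ∧
      (∀ (P₁ P₂ : ContPathCovering X) (e₁ : P₁.E) (e₂ : P₂.E),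
        Topology.IsQuotientMap (BasedPath.ev₁ e₁) → Topology.IsQuotientMap (BasedPath.ev₁ e₂) →
        P₁.Corresponds e₁ H → P₂.Corresponds e₂ H → P₁.Equivalent P₂)) ∧
    (∀ (P₁ P₂ : ContPathCovering X) (e₁ : P₁.E) (e₂ : P₂.E)
      (H₁ H₂ : Subgroup (FundamentalGroup X x₀)),
      Topology.IsQuotientMap (BasedPath.ev₁ e₁) → Topology.IsQuotientMap (BasedPath.ev₁ e₂) →
      P₁.Corresponds e₁ H₁ → P₂.Corresponds e₂ H₂ →
        (P₁.Equivalent P₂ ↔ AreConjugate H₁ H₂)) ∧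
    -- (2) every map is weakly equivalent to one for which `ev₁` is quotient
    (∀ P : ContPathCovering X, ∃ P' : ContPathCovering X,
      P.WeaklyEquivalent P' ∧ ∀ e' : P'.E, Topology.IsQuotientMap (BasedPath.ev₁ e')) := by
  refine ⟨fun H => ⟨⟨?_, fun hH => ?_⟩, fun P₁ P₂ e₁ e₂ h₁ h₂ => h₁.weaklyEquivalent h₂⟩,
    fun P₁ P₂ e₁ e₂ H₁ H₂ h₁ h₂ => ⟨fun h => ?_, fun h => ?_⟩,
    fun H => ⟨⟨?_, fun hH => ?_⟩, fun P₁ P₂ e₁ e₂ hq₁ hq₂ h₁ h₂ => h₁.equivalent hq₁ hq₂ h₂⟩,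
    fun P₁ P₂ e₁ e₂ H₁ H₂ hq₁ hq₂ h₁ h₂ => ⟨fun h => ?_, fun h => ?_⟩, fun P => ?_⟩
  · rintro ⟨P, e₀, h⟩
    exact h.totallyPathDisconnected
  · exact ⟨_, _, PathSpaceQuotient.corresponds_contPathCovering hH⟩
  · obtain ⟨e, he⟩ := h.exists_corresponds h₁
    exact he.areConjugate h₂
  · obtain ⟨e, he⟩ := h₁.exists_of_areConjugate h
    exact he.weaklyEquivalent h₂
  · rintro ⟨P, e₀, -, h⟩
    exact h.totallyPathDisconnected
  · exact ⟨_, _, PathSpaceQuotient.isQuotientMap_ev₁,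
      PathSpaceQuotient.corresponds_contPathCovering hH⟩
  · obtain ⟨e, he⟩ := h.exists_corresponds h₁
    exact he.areConjugate h₂
  · obtain ⟨e, he⟩ := h₁.exists_of_areConjugate h
    exact he.equivalent (ContPathCovering.isQuotientMap_ev₁ hq₁ e) hq₂ h₂
  · obtain ⟨e⟩ := (inferInstance : Nonempty P.E)
    have h : P.Corresponds e (FundamentalGroup.mapOfEq P.p (rfl : P.p e = P.p e)).range :=
      ⟨rfl, rfl⟩
    have hH := h.totallyPathDisconnected
    exact ⟨PathSpaceQuotient.contPathCovering hH,
      h.weaklyEquivalent (PathSpaceQuotient.corresponds_contPathCovering hH),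
      ContPathCovering.isQuotientMap_ev₁ PathSpaceQuotient.isQuotientMap_ev₁⟩
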